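/- Let $n\ge 0$ be an integer. An $n\times n$ Sudoku is an $n^2\times n^2$ grid divided into $n^2$ blocks of $n\times n$ cells (arranged in $n$ row bands and $n$ column bands) that is to be filled with the digits $1,\dots,n^2$ so that every row, every column and every block contains each digit exactly once. Let $U,V\subseteq\{1,\dots,n\}$ with $|U|=c_1$ and $|V|=c_2$, and consider an $(n;c_1,c_2)$ partly filled Sudoku, i.e. one in which exactly the cells of the blocks in row band $u$ and column band $v$ with $(u,v)\in U\times V$ have already been filled, with arbitrary given digits. Then its number of solutions $S(n;c_1,c_2)$ (the number of completions of the grid satisfying all row, column and block constraints), whatever the given digits are, satisfies $$S(n;c_1,c_2)\le S_U(n;c_1,c_2):=\Biggl\{\prod_{i=1}^{c_1}\Bigl(\prod_{j=1}^{i}\mu(i,j;c_2)\Bigr)\Bigl(\prod_{j=i+1}^{n}\nu(j;c_2)\Bigr)\Biggr\}\times\Biggl\{\prod_{i=c_1+1}^{n}\Bigl(\prod_{j=1}^{i}\mu(i,j;0)\Bigr)\Bigl(\prod_{j=i+1}^{n}\nu(j;0)\Bigr)\Biggr\},$$ where $$\mu(i,j;c_2):=\bigl([n^2-(i-1)n-(j-1)]!\bigr)^{\frac{n^2-c_2n}{n^2-(i-1)n-(j-1)}},\qquad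 \nu(j;c_2):=\bigl([n^2-(j-1)n]!\bigr)^{\frac{n^2-c_2n}{n^2-(j-1)n}}.$$ Moreover $\mu(i,j;0)=\mu(i,j)$ for $1\le j\le i\le n$ and $\nu(j;0)=\nu(j)$ for $1\le j\le n$, where $\mu(i,j):=\bigl([n^2-(i-1)n-(j-1)]!\bigr)^{\frac{n^2}{n^2-(i-1)n-(j-1)}}$ and $\nu(j):=\bigl([n^2-(j-1)n]!\bigr)^{\frac{n^2}{n^2-(j-1)n}}$ are the factors in Herzberg's bound for the empty Sudoku. -/

import Mathlib

open scoped Nat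

/-- A position along one side of the grid of an `n × n` Sudoku: the pair `(b, k)` is the
`k`-th row (column) of the `b`-th row band (column band). -/
abbrev SudokuLine (n : ℕ) : Type := Fin n × Fin n

/-- A completely filled `n² × n²` grid; the element `d` of `Fin (n ^ 2)` stands for the digit
`d + 1`. -/
abbrev SudokuGrid (n : ℕ) : Type := SudokuLine n → SudokuLine n → Fin (n ^ 2)

/-- A puzzle: some cells carry a digit (`some d`), the others are empty (`none`). -/
abbrev SudokuPuzzle (n : ℕ) : Type := SudokuLine n → SudokuLine n → Option (Fin (n ^ 2))

/-- Every row, every column and every block contains every digit exactly once. -/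
structure IsSudoku {n : ℕ} (g : SudokuGrid n) : Prop where
  row : ∀ (r : SudokuLine n) (d : Fin (n ^ 2)), ∃! c : SudokuLine n, g r c = d
  column : ∀ (c : SudokuLine n) (d : Fin (n ^ 2)), ∃! r : SudokuLine n, g r c = d
  block : ∀ (u v : Fin n) (d : Fin (n ^ 2)), ∃! p : Fin n × Fin n, g (u, p.1) (v, p.2) = d

/-- The solutions to a puzzle: the Sudoku grids that agree with every given digit. -/
def SudokuPuzzle.solutions {n : ℕ} (P : SudokuPuzzle n) : Set (SudokuGrid n) :=
  {g | IsSudoku g ∧ ∀ r c d, P r c = some d → g r c = d}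

/-- The filled cells of `P` are exactly the cells of the blocks `(u, v)` with `u ∈ U`
and `v ∈ V`. -/
def SudokuPuzzle.IsFilledOn {n : ℕ} (P : SudokuPuzzle n) (U V : Finset (Fin n)) : Prop :=
  ∀ r c, (P r c).isSome ↔ r.1 ∈ U ∧ c.1 ∈ V

/-- `μ(i,j;c₂) = [n² - (i-1)n - (j-1)]! ^ ((n² - c₂n) / (n² - (i-1)n - (j-1)))`; it is used
for `1 ≤ j ≤ i ≤ n` only, where no subtraction of natural numbers truncates. -/
noncomputable def sudokuMu (n i j c₂ : ℕ) : ℝ :=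
  ((n ^ 2 - (i - 1) * n - (j - 1))! : ℝ) ^
    (((n : ℝ) ^ 2 - c₂ * n) / ((n : ℝ) ^ 2 - ((i : ℝ) - 1) * n - ((j : ℝ) - 1)))

/-- `ν(j;c₂) = [n² - (j-1)n]! ^ ((n² - c₂n) / (n² - (j-1)n))`; it is used for `1 ≤ j ≤ n`
only, where no subtraction of natural numbers truncates. -/
noncomputable def sudokuNu (n j c₂ : ℕ) : ℝ :=
  ((n ^ 2 - (j - 1) * n)! : ℝ) ^
    (((n : ℝ) ^ 2 - c₂ * n) / ((n : ℝ) ^ 2 - ((j : ℝ) - 1) * n))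

/-- Herzberg's factor `μ(i,j) = [n² - (i-1)n - (j-1)]! ^ (n² / (n² - (i-1)n - (j-1)))`. -/
noncomputable def herzbergMu (n i j : ℕ) : ℝ :=
  ((n ^ 2 - (i - 1) * n - (j - 1))! : ℝ) ^
    ((n : ℝ) ^ 2 / ((n : ℝ) ^ 2 - ((i : ℝ) - 1) * n - ((j : ℝ) - 1)))

/-- Herzberg's factor `ν(j) = [n² - (j-1)n]! ^ (n² / (n² - (j-1)n))`. -/
noncomputable def herzbergNu (n j : ℕ) : ℝ :=
  ((n ^ 2 - (j - 1) * n)! : ℝ) ^ ((n : ℝ) ^ 2 / ((n : ℝ) ^ 2 - ((j : ℝ) - 1) * n))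

/-- The upper bound `S_U(n;c₁,c₂)`. -/
noncomputable def sudokuUpperBound (n c₁ c₂ : ℕ) : ℝ :=
  (∏ i ∈ Finset.Icc 1 c₁,
      ((∏ j ∈ Finset.Icc 1 i, sudokuMu n i j c₂) *
        ∏ j ∈ Finset.Icc (i + 1) n, sudokuNu n j c₂)) *
    ∏ i ∈ Finset.Icc (c₁ + 1) n,
      ((∏ j ∈ Finset.Icc 1 i, sudokuMu n i j 0) *
        ∏ j ∈ Finset.Icc (i + 1) n, sudokuNu n j 0)

/-!
The rows are filled one after the other, the bands of `U` first. Once the rows before `r` are known,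
row `r` is a perfect matching between the `n²` columns and the `n²` digits: a given cell has one
admissible digit, and an empty cell has to avoid the digits already placed in its column (there are
`(i - 1) n + (j - 1)` of them if `r` is row `j` of the `i`-th band to be filled), and likewise those
already placed in its block (there are `(j - 1) n` of them). Bregman's theorem
`card_perfectMatchings_le` bounds the number of these matchings by the product of
`(r_c !) ^ (1 / r_c)` over the columns `c`, where `r_c` is the number of admissible digits. Given cells
contribute `1`; the `n² - c₂ n` (in the bands of `U`) or `n²` (elsewhere) empty cells all contribute
the same factor, which gives `μ` for the column constraint and `ν` for the block constraint
(`card_row_choices_le`). Either bound is valid for every row, and the theorem uses `μ` for `j ≤ i` and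
`ν` for `j > i`. Multiplying over the rows (`card_le_prod_of_card_choices_le`) gives the theorem.

Bregman's theorem is proved as by Schrijver: if `P` is the number of perfect matchings and `P i k` the
number of those that match `i` with `k`, convexity of `t log t` bounds `P log P` by
`P log r_i + ∑ k, P i k log (P i k)`; summing over `i` and applying induction to each `P i k` turns
the right-hand side into a sum over pairs of a perfect matching and an element, which is evaluated
matching by matching (`log_card_add_sum_matchAt`).
-/

/-! ### Bregman's theorem -/

section Bregman

variable {α β : Type*} [Fintype α] [Fintype β] [DecidableEq α] [DecidableEq β]

open Classical in
/-- The bijections `f : α → β` with `f a ∈ A a` for all `a`, i.e. the perfect matchings of the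
bipartite graph in which `a` is joined to the elements of `A a`. Their number is the permanent of
the `0`-`1` matrix whose row `a` is the indicator of `A a`. -/
noncomputable def perfectMatchings (A : α → Finset β) : Finset (α → β) :=
  Finset.univ.filter fun f => Function.Bijective f ∧ ∀ a, f a ∈ A a

lemma mem_perfectMatchings {A : α → Finset β} {f : α → β} :
    f ∈ perfectMatchings A ↔ Function.Bijective f ∧ ∀ a, f a ∈ A a := by
  simp [perfectMatchings]

/-- The sets `A` after `i` has been matched with `k`: the choice at `i` is fixed and `k` becomes
unavailable elsewhere. It plays the part of the minor at `(i, k)`, on the same index types. -/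
def matchAt (A : α → Finset β) (i : α) (k : β) : α → Finset β :=
  fun j => if j = i then {k} else (A j).erase k

lemma perfectMatchings_matchAt {A : α → Finset β} {i : α} {k : β} (hk : k ∈ A i) :
    perfectMatchings (matchAt A i k) = (perfectMatchings A).filter fun f => f i = k := by
  ext f
  simp only [Finset.mem_filter, mem_perfectMatchings, matchAt]
  constructor
  · rintro ⟨hf, h⟩
    have hi : f i = k := by simpa using h i
    refine ⟨⟨hf, fun a => ?_⟩, hi⟩
    by_cases ha : a = i
    · subst ha; rwa [hi]
    · have := h a
      rw [if_neg ha] at this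
      exact Finset.mem_of_mem_erase this
  · rintro ⟨⟨hf, h⟩, hi⟩
    refine ⟨hf, fun a => ?_⟩
    by_cases ha : a = i
    · subst ha; simp [hi]
    · rw [if_neg ha, Finset.mem_erase]
      exact ⟨fun e => ha (hf.1 (e.trans hi.symm)), h a⟩

/-- The logarithm of `(r!) ^ (1 / r)`. Its junk value at `r = 0` is `0`. -/
noncomputable def logFactorialMean (r : ℕ) : ℝ := Real.log (r ! : ℝ) / r

lemma logFactorialMean_one : logFactorialMean 1 = 0 := by simp [logFactorialMean]

lemma natCast_mul_logFactorialMean (r : ℕ) :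
    (r : ℝ) * logFactorialMean r = Real.log (r ! : ℝ) := by
  rcases Nat.eq_zero_or_pos r with rfl | hr
  · simp
  · have : (r : ℝ) ≠ 0 := by positivity
    rw [logFactorialMean]; field_simp

lemma sum_mul_log_sum_le {ι : Type*} (u : Finset ι) (hu : u.Nonempty) (t : ι → ℝ)
    (ht : ∀ k ∈ u, 0 ≤ t k) :
    (∑ k ∈ u, t k) * Real.log (∑ k ∈ u, t k) ≤
      (∑ k ∈ u, t k) * Real.log u.card + ∑ k ∈ u, t k * Real.log (t k) := by
  have hr : (0 : ℝ) < u.card := by exact_mod_cast hu.card_pos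
  have hJ := Real.convexOn_mul_log.map_sum_le (t := u) (w := fun _ => (u.card : ℝ)⁻¹) (p := t)
    (fun _ _ => by positivity) (by simp [hr.ne']) (fun k hk => ht k hk)
  simp only [smul_eq_mul, ← Finset.mul_sum] at hJ
  rcases (Finset.sum_nonneg ht).eq_or_lt with h0 | h0
  · rw [← h0] at hJ ⊢
    simp only [mul_zero, zero_mul, zero_add] at hJ ⊢
    exact (mul_nonneg_iff_of_pos_left (inv_pos.2 hr)).1 hJ
  · rw [Real.log_mul (by positivity) h0.ne', Real.log_inv, mul_assoc] at hJ
    have := le_of_mul_le_mul_left hJ (inv_pos.2 hr)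
    linarith

/-- The exchange of summation in Schrijver's proof: along a perfect matching `f`, the bounds for
the matchings through `(i, f i)`, `i ∈ s`, contribute exactly `s.card` times the term of `j` to the
bound. Outside of `s` every choice is forced and interferes with no other one. -/
lemma log_card_add_sum_matchAt {A : α → Finset β} {s : Finset α}
    (hs : ∀ a ∉ s, ∃ k, A a = {k} ∧ ∀ b, b ≠ a → k ∉ A b) {f : α → β}
    (hf : f ∈ perfectMatchings A) {j : α} (hj : j ∈ s) :
    Real.log (A j).card + ∑ i ∈ s, logFactorialMean (matchAt A i (f i) j).card =
      s.card * logFactorialMean (A j).card := by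
  obtain ⟨hbij, hfA⟩ := mem_perfectMatchings.1 hf
  set r := (A j).card with hr
  have hr0 : 0 < r := Finset.card_pos.2 ⟨_, hfA j⟩
  have hT : (s.filter fun i => f i ∈ A j).card = r := by
    rw [hr, ← Finset.card_image_of_injective _ hbij.1]
    congr 1
    ext y
    simp only [Finset.mem_image, Finset.mem_filter]
    constructor
    · rintro ⟨i, ⟨-, h⟩, rfl⟩; exact h
    · intro hy
      obtain ⟨i, rfl⟩ := hbij.2 y
      refine ⟨i, ⟨?_, hy⟩, rfl⟩
      by_contra his
      obtain ⟨k, hk, hk'⟩ := hs i his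
      have : f i = k := by simpa [hk] using hfA i
      exact hk' j (by rintro rfl; exact his hj) (this ▸ hy)
  have hT' : ((s.erase j).filter fun i => f i ∈ A j).card = r - 1 := by
    rw [Finset.filter_erase, Finset.card_erase_of_mem (by simp [hj, hfA j]), hT]
  have hsum : ((s.erase j).filter fun i => f i ∈ A j).card +
      ((s.erase j).filter fun i => ¬ f i ∈ A j).card = s.card - 1 := by
    rw [Finset.card_filter_add_card_filter_not, Finset.card_erase_of_mem hj]
  have hrs : r ≤ s.card := hT ▸ Finset.card_filter_le _ _
  have hT'' : ((s.erase j).filter fun i => ¬ f i ∈ A j).card = s.card - r := by omega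
  rw [← Finset.add_sum_erase s _ hj, ← Finset.sum_filter_add_sum_filter_not (s.erase j)
    (fun i => f i ∈ A j)]
  have h1 : ∑ i ∈ (s.erase j).filter (fun i => f i ∈ A j),
      logFactorialMean (matchAt A i (f i) j).card = (r - 1 : ℕ) * logFactorialMean (r - 1) := by
    rw [← hT', ← nsmul_eq_mul]
    refine Finset.sum_eq_card_nsmul fun i hi => ?_
    simp only [Finset.mem_filter, Finset.mem_erase] at hi
    rw [matchAt, if_neg (Ne.symm hi.1.1), Finset.card_erase_of_mem hi.2, hT']
  have h2 : ∑ i ∈ (s.erase j).filter (fun i => ¬ f i ∈ A j),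
      logFactorialMean (matchAt A i (f i) j).card = (s.card - r : ℕ) * logFactorialMean r := by
    rw [← hT'', ← nsmul_eq_mul]
    refine Finset.sum_eq_card_nsmul fun i hi => ?_
    simp only [Finset.mem_filter, Finset.mem_erase] at hi
    rw [matchAt, if_neg (Ne.symm hi.1.1), Finset.erase_eq_of_notMem hi.2]
  have h3 : Real.log r + Real.log ((r - 1)! : ℕ) = r * logFactorialMean r := by
    rw [natCast_mul_logFactorialMean, ← Real.log_mul (by positivity) (by positivity)]
    congr 1
    exact_mod_cast Nat.mul_factorial_pred hr0.ne'
  rw [h1, h2, natCast_mul_logFactorialMean, Nat.cast_sub hrs]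
  simp only [matchAt, if_true, Finset.card_singleton, logFactorialMean_one]
  linear_combination h3

/-- Bregman's theorem in logarithmic form. The induction is on the set `s` of the elements whose
choice is not yet forced. -/
lemma log_card_perfectMatchings_le (s : Finset α) (A : α → Finset β)
    (hs : ∀ a ∉ s, ∃ k, A a = {k} ∧ ∀ b, b ≠ a → k ∉ A b) (hA : (perfectMatchings A).Nonempty) :
    Real.log (perfectMatchings A).card ≤ ∑ a, logFactorialMean (A a).card := by
  induction hn : s.card generalizing s A with
  | zero =>
    obtain rfl := Finset.card_eq_zero.1 hn
    have h1 : (perfectMatchings A).card ≤ 1 := by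
      refine Finset.card_le_one.2 fun f hf g hg => funext fun a => ?_
      obtain ⟨k, hk, -⟩ := hs a (by simp)
      have hf' := (mem_perfectMatchings.1 hf).2 a
      have hg' := (mem_perfectMatchings.1 hg).2 a
      rw [hk, Finset.mem_singleton] at hf' hg'
      rw [hf', hg']
    have h2 : (perfectMatchings A).card = 1 := le_antisymm h1 hA.card_pos
    rw [h2, Finset.sum_eq_zero]
    · simp
    · intro a _
      obtain ⟨k, hk, -⟩ := hs a (by simp)
      rw [hk, Finset.card_singleton, logFactorialMean_one]
  | succ m ih =>
    have hP : (0 : ℝ) < (perfectMatchings A).card := by exact_mod_cast hA.card_pos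
    set t : α → β → ℝ := fun i k => ((perfectMatchings A).filter fun f => f i = k).card with ht
    have hmaps : ∀ i, ∀ f ∈ perfectMatchings A, f i ∈ A i :=
      fun i f hf => (mem_perfectMatchings.1 hf).2 i
    have hsum : ∀ i, ∑ k ∈ A i, t i k = (perfectMatchings A).card := fun i => by
      rw [ht, Finset.card_eq_sum_card_fiberwise (hmaps i)]; push_cast; rfl
    have hfib : ∀ i, ∑ k ∈ A i, t i k * Real.log (t i k) =
        ∑ f ∈ perfectMatchings A, Real.log (t i (f i)) := fun i => by
      rw [← Finset.sum_fiberwise_of_maps_to (hmaps i)]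
      refine Finset.sum_congr rfl fun k _ => ?_
      rw [← nsmul_eq_mul]
      refine (Finset.sum_eq_card_nsmul fun f hf => ?_).symm
      rw [(Finset.mem_filter.1 hf).2]
    have hJ : ∀ i, (perfectMatchings A).card * Real.log (perfectMatchings A).card ≤
        ∑ f ∈ perfectMatchings A, (Real.log (A i).card + Real.log (t i (f i))) := fun i => by
      obtain ⟨f₀, hf₀⟩ := hA
      have := sum_mul_log_sum_le (A i) ⟨_, hmaps i f₀ hf₀⟩ (t i) (fun _ _ => Nat.cast_nonneg _)
      rw [hsum, hfib] at this
      rwa [Finset.sum_add_distrib, Finset.sum_const, nsmul_eq_mul]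
    have hIH : ∀ f ∈ perfectMatchings A, ∀ i ∈ s,
        Real.log (t i (f i)) ≤ ∑ j, logFactorialMean (matchAt A i (f i) j).card := by
      intro f hf i hi
      have hfi := hmaps i f hf
      simp only [ht]
      rw [← perfectMatchings_matchAt hfi]
      refine ih (s.erase i) _ (fun a ha => ?_) ⟨f, ?_⟩ (by rw [Finset.card_erase_of_mem hi, hn]; rfl)
      · by_cases hai : a = i
        · subst hai
          exact ⟨f a, by simp [matchAt], fun b hb => by simp [matchAt, hb]⟩
        · obtain ⟨k, hk, hk'⟩ := hs a (fun h => ha (Finset.mem_erase.2 ⟨hai, h⟩))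
          have hki : f i ≠ k := fun h => hk' i (Ne.symm hai) (h ▸ hfi)
          refine ⟨k, ?_, fun b hb => ?_⟩
          · rw [matchAt, if_neg hai, hk, Finset.erase_eq_of_notMem (by simpa using hki)]
          · by_cases hbi : b = i
            · simp [matchAt, hbi, Ne.symm hki]
            · simp [matchAt, hbi, hk' b hb]
      · rw [perfectMatchings_matchAt hfi]; simp [hf]
    have hrow : ∀ f ∈ perfectMatchings A,
        ∑ i ∈ s, (Real.log (A i).card + Real.log (t i (f i))) ≤
          s.card * ∑ j, logFactorialMean (A j).card := by
      intro f hf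
      have hout : ∀ j ∉ s, logFactorialMean (A j).card = 0 ∧
          ∑ i ∈ s, logFactorialMean (matchAt A i (f i) j).card = 0 := by
        intro j hj
        obtain ⟨k, hk, hk'⟩ := hs j hj
        refine ⟨by rw [hk, Finset.card_singleton, logFactorialMean_one],
          Finset.sum_eq_zero fun i hi => ?_⟩
        have hij : j ≠ i := by rintro rfl; exact hj hi
        have hki : f i ≠ k := fun h => hk' i hij.symm (h ▸ hmaps i f hf)
        rw [matchAt, if_neg hij, hk, Finset.erase_eq_of_notMem (by simpa using hki),
          Finset.card_singleton, logFactorialMean_one]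
      calc ∑ i ∈ s, (Real.log (A i).card + Real.log (t i (f i)))
          ≤ ∑ i ∈ s, (Real.log (A i).card +
              ∑ j, logFactorialMean (matchAt A i (f i) j).card) :=
            Finset.sum_le_sum fun i hi => by linarith [hIH f hf i hi]
        _ = ∑ j ∈ s, (Real.log (A j).card +
              ∑ i ∈ s, logFactorialMean (matchAt A i (f i) j).card) := by
            rw [Finset.sum_add_distrib, Finset.sum_comm, Finset.sum_add_distrib]
            congr 1
            exact (Finset.sum_subset (Finset.subset_univ s) fun j _ hj => (hout j hj).2).symm
        _ = s.card * ∑ j, logFactorialMean (A j).card := by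
            rw [← Finset.sum_subset (Finset.subset_univ s) fun j _ hj => (hout j hj).1,
              Finset.mul_sum]
            exact Finset.sum_congr rfl fun j hj => log_card_add_sum_matchAt hs hf hj
    have hsc : (0 : ℝ) < s.card := by rw [hn]; positivity
    have hfinal : (s.card * (perfectMatchings A).card : ℝ) * Real.log (perfectMatchings A).card ≤
        (s.card * (perfectMatchings A).card : ℝ) * ∑ j, logFactorialMean (A j).card := by
      calc _ = ∑ i ∈ s, ((perfectMatchings A).card : ℝ) * Real.log (perfectMatchings A).card := by
            rw [Finset.sum_const, nsmul_eq_mul]; ring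
        _ ≤ ∑ i ∈ s, ∑ f ∈ perfectMatchings A,
              (Real.log (A i).card + Real.log (t i (f i))) := Finset.sum_le_sum fun i _ => hJ i
        _ = ∑ f ∈ perfectMatchings A, ∑ i ∈ s,
              (Real.log (A i).card + Real.log (t i (f i))) := Finset.sum_comm
        _ ≤ ∑ _f ∈ perfectMatchings A, s.card * ∑ j, logFactorialMean (A j).card :=
            Finset.sum_le_sum hrow
        _ = _ := by rw [Finset.sum_const, nsmul_eq_mul]; ring
    exact le_of_mul_le_mul_left hfinal (mul_pos hsc hP)

/-- **Bregman's theorem** (the Minc conjecture) on the permanent of a `0`-`1` matrix. -/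
theorem card_perfectMatchings_le (A : α → Finset β) :
    ((perfectMatchings A).card : ℝ) ≤ ∏ a, ((A a).card ! : ℝ) ^ (1 / ((A a).card : ℝ)) := by
  rcases (perfectMatchings A).eq_empty_or_nonempty with h | h
  · rw [h, Finset.card_empty, Nat.cast_zero]
    positivity
  · have hlog := log_card_perfectMatchings_le Finset.univ A (by simp) h
    rw [Real.log_le_iff_le_exp (by exact_mod_cast h.card_pos), Real.exp_sum] at hlog
    refine hlog.trans (le_of_eq (Finset.prod_congr rfl fun a _ => ?_))
    rw [Real.rpow_def_of_pos (by positivity), logFactorialMean, mul_one_div]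

lemma card_perfectMatchings_le_of_card_eq (A : α → Finset β) (E : Finset α) (K : ℕ) (h₁ : ∀ c ∈ E, (A c).card = 1)
    (h₂ : ∀ c ∉ E, (A c).card = K) :
    ((perfectMatchings A).card : ℝ) ≤
      (K ! : ℝ) ^ (((Fintype.card α : ℝ) - E.card) / (K : ℝ)) := by
  refine (card_perfectMatchings_le A).trans (le_of_eq ?_)
  rw [← Finset.prod_mul_prod_compl E, Finset.prod_eq_one, one_mul,
    Finset.prod_eq_pow_card (b := (K ! : ℝ) ^ (1 / (K : ℝ))), ← Real.rpow_natCast,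
    ← Real.rpow_mul (by positivity), Finset.card_compl, Nat.cast_sub (Finset.card_le_univ _)]
  · congr 1; ring
  · intro c hc
    rw [h₂ c (Finset.mem_compl.1 hc)]
  · intro c hc
    simp [h₁ c hc]

end Bregman

/-! ### Counting by successive choices -/

/-- If the entries of the members of `S` are determined one after the other, in the order given by
`ρ`, and there are at most `B r` possibilities for the entry at `r` once the entries before it are
known, then `S` has at most `∏ r, B r` members. -/
lemma card_le_prod_of_card_choices_le {R X : Type*} [Fintype R] [DecidableEq R] [DecidableEq X]
    (ρ : R → ℕ) (S : Finset (R → X)) (B : R → ℝ) (hB : ∀ r, 0 ≤ B r)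
    (h : ∀ g ∈ S, ∀ r,
      (((S.filter fun h => ∀ r', ρ r' < ρ r → h r' = g r').image fun h => h r).card : ℝ) ≤ B r) :
    (S.card : ℝ) ≤ ∏ r, B r := by
  have key : ∀ T : Finset R, ∀ g ∈ S,
      ((S.filter fun h => ∀ r ∉ T, h r = g r).card : ℝ) ≤ ∏ r ∈ T, B r := by
    intro T
    -- `T` is the set of the entries still to be determined; a first one of them is added to it.
    induction T using Finset.induction_on_min_value ρ with
    | empty =>
      intro g hg
      have : (S.filter fun h => ∀ r ∉ (∅ : Finset R), h r = g r).card ≤ 1 :=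
        Finset.card_le_one.2 fun a ha b hb => funext fun r => by
          rw [(Finset.mem_filter.1 ha).2 r (by simp), (Finset.mem_filter.1 hb).2 r (by simp)]
      simpa using this
    | insert a T haT hmin ih =>
      intro g hg
      set F := S.filter fun h => ∀ r ∉ insert a T, h r = g r with hF
      have hfib : ∀ x ∈ F.image (fun h => h a),
          ((F.filter fun h => h a = x).card : ℝ) ≤ ∏ r ∈ T, B r := by
        intro x hx
        obtain ⟨h₀, hh₀, rfl⟩ := Finset.mem_image.1 hx
        obtain ⟨hS₀, hg₀⟩ := Finset.mem_filter.1 hh₀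
        refine le_trans ?_ (ih h₀ hS₀)
        norm_cast
        refine Finset.card_le_card fun h hh => ?_
        obtain ⟨hhF, hha⟩ := Finset.mem_filter.1 hh
        obtain ⟨hhS, hhg⟩ := Finset.mem_filter.1 hhF
        refine Finset.mem_filter.2 ⟨hhS, fun r hr => ?_⟩
        by_cases hra : r = a
        · rw [hra]; exact hha
        · have : r ∉ insert a T := by simp [hra, hr]
          rw [hhg r this, hg₀ r this]
      have himg : ((F.image fun h => h a).card : ℝ) ≤ B a := by
        refine le_trans ?_ (h g hg a)
        norm_cast
        refine Finset.card_le_card (Finset.image_subset_image fun h hh => ?_)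
        obtain ⟨hhS, hhg⟩ := Finset.mem_filter.1 hh
        refine Finset.mem_filter.2 ⟨hhS, fun r hr => hhg r fun hmem => ?_⟩
        rcases Finset.mem_insert.1 hmem with rfl | hrT
        · exact lt_irrefl _ hr
        · exact absurd (hmin r hrT) (not_le.2 hr)
      rw [Finset.prod_insert haT, Finset.card_eq_sum_card_image (fun h => h a) F]
      push_cast
      calc _ ≤ ∑ _x ∈ F.image (fun h => h a), ∏ r ∈ T, B r := Finset.sum_le_sum hfib
        _ = (F.image fun h => h a).card * ∏ r ∈ T, B r := by
            rw [Finset.sum_const, nsmul_eq_mul]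
        _ ≤ _ := mul_le_mul_of_nonneg_right himg (Finset.prod_nonneg fun r _ => hB r)
  rcases S.eq_empty_or_nonempty with rfl | ⟨g, hg⟩
  · simpa using Finset.prod_nonneg fun r _ => hB r
  · simpa using key Finset.univ g hg

/-! ### The number of choices for one row -/

namespace IsSudoku

variable {n : ℕ} {g h : SudokuGrid n}

lemma row_bijective (hg : IsSudoku g) (r : SudokuLine n) : Function.Bijective (g r) :=
  (Function.bijective_iff_existsUnique _).2 (hg.row r)

lemma column_injective (hg : IsSudoku g) (c : SudokuLine n) :
    Function.Injective fun r => g r c :=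
  ((Function.bijective_iff_existsUnique _).2 (hg.column c)).1

lemma block_injective (hg : IsSudoku g) (u v : Fin n) :
    Function.Injective fun p : Fin n × Fin n => g (u, p.1) (v, p.2) :=
  ((Function.bijective_iff_existsUnique _).2 (hg.block u v)).1

end IsSudoku

/-- The order in which the rows are filled: by the position of their band under the permutation
`w`, and from top to bottom within a band. -/
def rowOrder {n : ℕ} (w : Equiv.Perm (Fin n)) : SudokuLine n ≃ Fin (n * n) :=
  (Equiv.prodCongr w (Equiv.refl _)).trans finProdFinEquiv

lemma rowOrder_val {n : ℕ} (w : Equiv.Perm (Fin n)) (r : SudokuLine n) :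
    (rowOrder w r : ℕ) = w r.1 * n + r.2 := by
  simp [rowOrder, add_comm, mul_comm]

lemma card_rowOrder_lt {n : ℕ} (w : Equiv.Perm (Fin n)) (r : SudokuLine n) :
    (Finset.univ.filter fun r' => rowOrder w r' < rowOrder w r).card = w r.1 * n + r.2 := by
  rw [← rowOrder_val, ← Fin.card_Iio, ← Finset.card_map (rowOrder w).toEmbedding]
  congr 1
  ext x
  simp only [Finset.mem_map_equiv, Finset.mem_filter, Finset.mem_univ, true_and,
    Equiv.apply_symm_apply, Finset.mem_Iio]

/-- The digits that stand in column `c` of `g` in a row before `r`. -/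
def columnUsed {n : ℕ} (w : Equiv.Perm (Fin n)) (g : SudokuGrid n) (r c : SudokuLine n) :
    Finset (Fin (n ^ 2)) :=
  (Finset.univ.filter fun r' => rowOrder w r' < rowOrder w r).image fun r' => g r' c

/-- The digits that stand above row `r` in the block of the cell `(r, c)` of `g`. -/
def blockUsed {n : ℕ} (g : SudokuGrid n) (r c : SudokuLine n) : Finset (Fin (n ^ 2)) :=
  (Finset.Iio r.2 ×ˢ Finset.univ).image fun p => g (r.1, p.1) (c.1, p.2)

lemma card_columnUsed {n : ℕ} (w : Equiv.Perm (Fin n)) {g : SudokuGrid n} (hg : IsSudoku g)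
    (r c : SudokuLine n) : (columnUsed w g r c).card = w r.1 * n + r.2 := by
  rw [columnUsed, Finset.card_image_of_injective _ (hg.column_injective c), card_rowOrder_lt]

lemma card_blockUsed {n : ℕ} {g : SudokuGrid n} (hg : IsSudoku g) (r c : SudokuLine n) :
    (blockUsed g r c).card = r.2 * n := by
  rw [blockUsed, Finset.card_image_of_injective _ (hg.block_injective r.1 c.1)]
  simp

/-- Once the rows before `r` agree with those of `g`, the cell `(r, c)` holds a digit that is new
in its column and in its block. -/
lemma notMem_columnUsed_blockUsed {n : ℕ} (w : Equiv.Perm (Fin n)) {g h : SudokuGrid n}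
    (hh : IsSudoku h) {r : SudokuLine n}
    (hgh : ∀ r', (rowOrder w r' : ℕ) < rowOrder w r → h r' = g r') (c : SudokuLine n) :
    h r c ∉ columnUsed w g r c ∧ h r c ∉ blockUsed g r c := by
  constructor
  · intro hmem
    obtain ⟨r', hr', he⟩ := Finset.mem_image.1 hmem
    have hlt := (Finset.mem_filter.1 hr').2
    rw [← hgh r' hlt] at he
    have := hh.column_injective c he
    exact absurd hlt (by rw [this]; exact lt_irrefl _)
  · intro hmem
    obtain ⟨p, hp, he⟩ := Finset.mem_image.1 hmem
    have hlt : p.1 < r.2 := by simpa using hp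
    have hlt' : (rowOrder w (r.1, p.1) : ℕ) < rowOrder w r := by
      rw [rowOrder_val, rowOrder_val]
      exact Nat.add_lt_add_left hlt _
    rw [← hgh _ hlt'] at he
    have := hh.block_injective r.1 c.1 (a₁ := p) (a₂ := (r.2, c.2)) he
    rw [this] at hlt
    exact lt_irrefl _ hlt

/-- The factor of the upper bound for row `j` of the `i`-th band to be filled: in the first `i` rows
of the band the column constraint is used, in the others the block constraint. -/
noncomputable def rowFactor (n i j c : ℕ) : ℝ :=
  if j ≤ i then sudokuMu n i j c else sudokuNu n j c

lemma rowFactor_nonneg (n i j c : ℕ) : 0 ≤ rowFactor n i j c := by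
  unfold rowFactor sudokuMu sudokuNu
  split_ifs <;> positivity

lemma sudokuMu_succ {n a b : ℕ} (c : ℕ) (h : a * n + b ≤ n ^ 2) :
    sudokuMu n (a + 1) (b + 1) c =
      ((n ^ 2 - (a * n + b))! : ℝ) ^
        (((n : ℝ) ^ 2 - c * n) / ((n ^ 2 - (a * n + b) : ℕ) : ℝ)) := by
  rw [sudokuMu, Nat.cast_sub h, Nat.add_sub_cancel, Nat.add_sub_cancel, Nat.sub_sub]
  push_cast
  congr 2
  ring

lemma sudokuNu_succ {n b : ℕ} (c : ℕ) (h : b * n ≤ n ^ 2) :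
    sudokuNu n (b + 1) c =
      ((n ^ 2 - b * n)! : ℝ) ^ (((n : ℝ) ^ 2 - c * n) / ((n ^ 2 - b * n : ℕ) : ℝ)) := by
  rw [sudokuNu, Nat.cast_sub h, Nat.add_sub_cancel]
  push_cast
  congr 2
  ring

/-- The number of possibilities for row `r` when the rows before it are those of the solution
`g`. Here `W` is the set of the column bands in which row `r` is given. -/
lemma card_row_choices_le {n : ℕ} (w : Equiv.Perm (Fin n)) {P : SudokuPuzzle n}
    {S : Finset (SudokuGrid n)} (hS : ∀ g ∈ S, g ∈ P.solutions) {g : SudokuGrid n} (hg : g ∈ S)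
    (r : SudokuLine n) (W : Finset (Fin n)) (hW : ∀ c : SudokuLine n, c.1 ∈ W → (P r c).isSome) :
    (((S.filter fun h => ∀ r', (rowOrder w r' : ℕ) < rowOrder w r → h r' = g r').image
      fun h => h r).card : ℝ) ≤ rowFactor n (w r.1 + 1) (r.2 + 1) W.card := by
  have hgs := (hS g hg).1
  set E : Finset (SudokuLine n) := W ×ˢ Finset.univ with hE
  have hEcard : ((Fintype.card (SudokuLine n) : ℝ) - E.card) = (n : ℝ) ^ 2 - W.card * n := by
    simp [hE, sq]
  -- A single argument for both constraints: `used c` are the digits excluded at `(r, c)`.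
  have key : ∀ (used : SudokuLine n → Finset (Fin (n ^ 2))) (m : ℕ), (∀ c, (used c).card = m) →
      (∀ h, IsSudoku h → (∀ r', (rowOrder w r' : ℕ) < rowOrder w r → h r' = g r') →
        ∀ c, h r c ∉ used c) →
      (((S.filter fun h => ∀ r', (rowOrder w r' : ℕ) < rowOrder w r → h r' = g r').image
        fun h => h r).card : ℝ) ≤
        ((n ^ 2 - m)! : ℝ) ^ (((n : ℝ) ^ 2 - W.card * n) / ((n ^ 2 - m : ℕ) : ℝ)) := by
    intro used m hm hused
    have hB := card_perfectMatchings_le_of_card_eq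
      (fun c => if c ∈ E then {g r c} else (used c)ᶜ) E (n ^ 2 - m)
      (fun c hc => by simp [hc]) (fun c hc => by simp [hc, Finset.card_compl, hm])
    rw [hEcard] at hB
    refine le_trans ?_ hB
    norm_cast
    refine Finset.card_le_card fun x hx => ?_
    obtain ⟨h, hh, rfl⟩ := Finset.mem_image.1 hx
    obtain ⟨hhS, hhg⟩ := Finset.mem_filter.1 hh
    obtain ⟨hhs, hhP⟩ := hS h hhS
    refine mem_perfectMatchings.2 ⟨hhs.row_bijective r, fun c => ?_⟩
    by_cases hc : c ∈ E
    · obtain ⟨d, hd⟩ := Option.isSome_iff_exists.1 (hW c (Finset.mem_product.1 hc).1)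
      rw [if_pos hc, Finset.mem_singleton, hhP r c d hd, (hS g hg).2 r c d hd]
    · rw [if_neg hc, Finset.mem_compl]
      exact hused h hhs hhg c
  rw [rowFactor]
  split_ifs
  · rw [sudokuMu_succ _ (by rw [← rowOrder_val, sq]; exact (rowOrder w r).2.le)]
    exact key (columnUsed w g r) _ (card_columnUsed w hgs r)
      fun h hh hhg c => (notMem_columnUsed_blockUsed w hh hhg c).1
  · rw [sudokuNu_succ _ (by rw [sq]; exact Nat.mul_le_mul_right n r.2.2.le)]
    exact key (blockUsed g r) _ (card_blockUsed hgs r)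
      fun h hh hhg c => (notMem_columnUsed_blockUsed w hh hhg c).2

/-! ### The product over all rows -/

lemma prod_Icc_split (f : ℕ → ℝ) {m n : ℕ} (h : m ≤ n) :
    (∏ i ∈ Finset.Icc 1 m, f i) * ∏ i ∈ Finset.Icc (m + 1) n, f i = ∏ i ∈ Finset.Icc 1 n, f i :=
  Finset.prod_Ico_consecutive f (Nat.succ_le_succ (Nat.zero_le m)) (Nat.succ_le_succ h)

lemma prod_fin_succ_eq_prod_Icc (n : ℕ) (f : ℕ → ℝ) :
    ∏ x : Fin n, f (x + 1) = ∏ i ∈ Finset.Icc 1 n, f i := by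
  rw [Fin.prod_univ_eq_prod_range (fun i => f (i + 1)), Finset.range_eq_Ico,
    Finset.prod_Ico_add' f 0 n 1]
  rfl

lemma prod_rowFactor (n c : ℕ) {i : ℕ} (hi : i ≤ n) :
    ∏ j ∈ Finset.Icc 1 n, rowFactor n i j c =
      (∏ j ∈ Finset.Icc 1 i, sudokuMu n i j c) * ∏ j ∈ Finset.Icc (i + 1) n, sudokuNu n j c := by
  rw [← prod_Icc_split _ hi]
  congr 1
  · exact Finset.prod_congr rfl fun j hj => if_pos (Finset.mem_Icc.1 hj).2
  · exact Finset.prod_congr rfl fun j hj => if_neg (not_le.2 (Finset.mem_Icc.1 hj).1)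

lemma prod_rows_rowFactor {n c₁ : ℕ} (c₂ : ℕ) (hc : c₁ ≤ n) (w : Equiv.Perm (Fin n)) :
    ∏ r : SudokuLine n,
      rowFactor n (w r.1 + 1) (r.2 + 1) (if (w r.1 : ℕ) < c₁ then c₂ else 0) =
      sudokuUpperBound n c₁ c₂ := by
  rw [Fintype.prod_prod_type]
  simp only
  rw [Equiv.prod_comp w fun x : Fin n =>
    ∏ y : Fin n, rowFactor n (x + 1) (y + 1) (if (x : ℕ) < c₁ then c₂ else 0)]
  calc _ = ∏ x : Fin n, ∏ j ∈ Finset.Icc 1 n,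
          rowFactor n (x + 1) j (if (x : ℕ) + 1 ≤ c₁ then c₂ else 0) :=
        Finset.prod_congr rfl fun x _ =>
          prod_fin_succ_eq_prod_Icc n fun j => rowFactor n (x + 1) j _
    _ = ∏ i ∈ Finset.Icc 1 n, ∏ j ∈ Finset.Icc 1 n,
          rowFactor n i j (if i ≤ c₁ then c₂ else 0) :=
        prod_fin_succ_eq_prod_Icc n fun i =>
          ∏ j ∈ Finset.Icc 1 n, rowFactor n i j (if i ≤ c₁ then c₂ else 0)
    _ = _ := by
        rw [← prod_Icc_split _ hc, sudokuUpperBound]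
        congr 1
        · refine Finset.prod_congr rfl fun i hi => ?_
          have hi' := (Finset.mem_Icc.1 hi).2
          rw [if_pos hi', prod_rowFactor n c₂ (hi'.trans hc)]
        · refine Finset.prod_congr rfl fun i hi => ?_
          have hi' := Finset.mem_Icc.1 hi
          rw [if_neg (not_le.2 hi'.1), prod_rowFactor n 0 hi'.2]

/-- The bands of `U` can be put first. -/
lemma exists_perm_lt_card_iff_mem {n : ℕ} (U : Finset (Fin n)) :
    ∃ w : Equiv.Perm (Fin n), ∀ b, (w b : ℕ) < U.card ↔ b ∈ U := by
  have hU : U.card ≤ n := by simpa using Finset.card_le_univ U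
  have hcard : Fintype.card {b // b ∈ U} = Fintype.card {x : Fin n // (x : ℕ) < U.card} := by
    rw [Fintype.card_coe, Fintype.card_subtype, Fin.card_filter_val_lt, min_eq_right hU]
  let e := Fintype.equivOfCardEq hcard
  refine ⟨e.extendSubtype, fun b => ⟨fun h => ?_, fun h => e.extendSubtype_mem b h⟩⟩
  by_contra hb
  exact e.extendSubtype_not_mem b hb h

theorem theorem3 (n c₁ c₂ : ℕ) :
    (∀ (U V : Finset (Fin n)), U.card = c₁ → V.card = c₂ →
      ∀ P : SudokuPuzzle n, P.IsFilledOn U V →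
        (P.solutions.ncard : ℝ) ≤ sudokuUpperBound n c₁ c₂) ∧
    (∀ i j : ℕ, 1 ≤ j → j ≤ i → i ≤ n → sudokuMu n i j 0 = herzbergMu n i j) ∧
    (∀ j : ℕ, 1 ≤ j → j ≤ n → sudokuNu n j 0 = herzbergNu n j) := by
  refine ⟨?_, fun i j _ _ _ => by simp [sudokuMu, herzbergMu],
    fun j _ _ => by simp [sudokuNu, herzbergNu]⟩
  rintro U V rfl rfl P hP
  obtain ⟨w, hw⟩ := exists_perm_lt_card_iff_mem U
  have hU : U.card ≤ n := by simpa using Finset.card_le_univ U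
  rw [Set.ncard_eq_toFinset_card _ P.solutions.toFinite, ← prod_rows_rowFactor V.card hU w]
  refine card_le_prod_of_card_choices_le (fun r => (rowOrder w r : ℕ)) _ _
    (fun r => rowFactor_nonneg _ _ _ _) fun g hg r => ?_
  have hS : ∀ g ∈ P.solutions.toFinite.toFinset, g ∈ P.solutions :=
    fun g hg => (Set.Finite.mem_toFinset _).1 hg
  split_ifs with hr
  · exact card_row_choices_le w hS hg r V fun c hc => (hP r c).2 ⟨(hw r.1).1 hr, hc⟩
  · exact card_row_choices_le w hS hg r ∅ fun c hc => absurd hc (Finset.notMem_empty _)
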